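/- Let $\lambda_1,\lambda_2>0$ and $K\ge 4$ be real numbers. For an irrational $\beta\in[0,1]$ put $$a(n)=(\lambda_1-\lambda_2)\bigl(\lfloor (n+1)\beta\rfloor-\lfloor n\beta\rfloor\bigr)+\lambda_2\qquad(n\in\mathbb Z),$$ and let $H$ be the bounded self-adjoint operator on $\ell^2(\mathbb Z)$ given by $(H\psi)(n)=a(n)\psi(n+1)+a(n-1)\psi(n-1)$ (the off-diagonal Sturmian model). Let $(\delta_n)_{n\in\mathbb Z}$ be the canonical basis and define, for $T>0$ and $N\in\mathbb N$, $$\langle a(n,T)\rangle=\frac2T\int_0^\infty e^{-2t/T}\,\bigl|\langle e^{-itH}\delta_1,\delta_n\rangle\bigr|^2\,dt,\qquad \langle P(N,T)\rangle=\sum_{|n|>N}\langle a(n,T)\rangle .$$ For $z\in\mathbb C$ and $n\ge 1$ let $F(n,z)=T_n(z)\cdots T_1(z)$, where $$T_m(z)=\frac1{a(m)}\begin{pmatrix} z&-1\\ a(m)^2&0\end{pmatrix},$$ and let $\|\cdot\|$ be the operator norm on $2\times2$ complex matrices induced by the Euclidean norm on $\mathbb C^2$. There are constants $c>0$ and $C>0$,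 depending only on $\lambda_1,\lambda_2,K$, such that for every irrational $\beta\in[0,1]$ with $\sigma(H)\subset[-K+1,K-1]$, every integer $N\ge1$ and every real $T>0$, $$\langle P(N,T)\rangle\;\le\; C\left(e^{-cN}+T^3\int_{-K}^{K}\Bigl(\max_{1\le n\le N}\bigl\|F\bigl(n,E+\tfrac iT\bigr)\bigr\|^2\Bigr)^{-1}dE\right).$$ -/

import Mathlib

open scoped ENNReal

namespace OffDiagSturm

/-- The complex Hilbert space `ℓ²(ℤ)`. -/
abbrev ell2Z : Type := lp (fun _ : ℤ => ℂ) 2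

/-- The canonical basis vector `δ_n`. -/
noncomputable def delta (n : ℤ) : ell2Z := lp.single 2 n (1 : ℂ)

/-- The pointwise action of the Jacobi operator on sequences,
`(Hψ)(n) = a(n) ψ(n+1) + a(n-1) ψ(n-1) + b(n) ψ(n)`. -/
noncomputable def jacobiFun (a b : ℤ → ℝ) (ψ : ℤ → ℂ) (n : ℤ) : ℂ :=
  (a n : ℂ) * ψ (n + 1) + (a (n - 1) : ℂ) * ψ (n - 1) + (b n : ℂ) * ψ n

theorem memℓp_two_iff (f : ℤ → ℂ) :
    Memℓp (E := fun _ : ℤ => ℂ) f 2 ↔ Summable fun i => ‖f i‖ ^ (2 : ℕ) := by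
  rw [memℓp_gen_iff (by norm_num)]
  norm_num

theorem memℓp_shift (ψ : ell2Z) (k : ℤ) :
    Memℓp (E := fun _ : ℤ => ℂ) (fun n => ψ (n + k)) 2 := by
  rw [memℓp_two_iff]
  exact ((memℓp_two_iff _).1 (lp.memℓp ψ)).comp_injective (add_left_injective k)

theorem memℓp_bdd_mul {a : ℤ → ℝ} (ha : ∃ C, ∀ n, |a n| ≤ C) {f : ℤ → ℂ}
    (hf : Memℓp (E := fun _ : ℤ => ℂ) f 2) :
    Memℓp (E := fun _ : ℤ => ℂ) (fun n => (a n : ℂ) * f n) 2 := by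
  obtain ⟨C, hC⟩ := ha
  rw [memℓp_two_iff] at hf ⊢
  refine Summable.of_nonneg_of_le (fun _ => by positivity) (fun n => ?_) (hf.mul_left (C ^ 2))
  rw [norm_mul, mul_pow, Complex.norm_real, Real.norm_eq_abs]
  have := hC n
  gcongr

theorem jacobiFun_memℓp {a b : ℤ → ℝ} (ha : ∃ C, ∀ n, |a n| ≤ C) (hb : ∃ C, ∀ n, |b n| ≤ C)
    (ψ : ell2Z) : Memℓp (E := fun _ : ℤ => ℂ) (jacobiFun a b ψ) 2 := by
  have ha' : ∃ C, ∀ n, |a (n - 1)| ≤ C := by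
    obtain ⟨C, hC⟩ := ha
    exact ⟨C, fun n => hC _⟩
  exact ((memℓp_bdd_mul ha (memℓp_shift ψ 1)).add
    (memℓp_bdd_mul ha' (memℓp_shift ψ (-1)))).add (memℓp_bdd_mul hb (lp.memℓp ψ))

/-- The Jacobi operator as a linear map of `ℓ²(ℤ)`. -/
noncomputable def jacobiLin (a b : ℤ → ℝ) (ha : ∃ C, ∀ n, |a n| ≤ C)
    (hb : ∃ C, ∀ n, |b n| ≤ C) : ell2Z →ₗ[ℂ] ell2Z where
  toFun ψ := ⟨jacobiFun a b ψ, jacobiFun_memℓp ha hb ψ⟩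
  map_add' ψ φ := by
    ext n
    change jacobiFun a b (⇑(ψ + φ)) n = jacobiFun a b ψ n + jacobiFun a b φ n
    simp only [jacobiFun, lp.coeFn_add, Pi.add_apply]
    ring
  map_smul' c ψ := by
    ext n
    change jacobiFun a b (⇑(c • ψ)) n = c • jacobiFun a b ψ n
    simp only [jacobiFun, lp.coeFn_smul, Pi.smul_apply, smul_eq_mul]
    ring

theorem jacobiLin_continuous (a b : ℤ → ℝ) (ha : ∃ C, ∀ n, |a n| ≤ C)
    (hb : ∃ C, ∀ n, |b n| ≤ C) : Continuous (jacobiLin a b ha hb) := by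
  refine LinearMap.continuous_of_seq_closed_graph _ fun u x y hu hy => ?_
  have ev : ∀ n : ℤ, Continuous fun f : ell2Z => f n := fun n =>
    (lp.lipschitzWith_one_eval (E := fun _ : ℤ => ℂ) 2 n).continuous
  ext n
  refine tendsto_nhds_unique (((ev n).tendsto y).comp hy) ?_
  have h : Continuous fun f : ell2Z => jacobiFun a b f n := by
    unfold jacobiFun
    exact ((continuous_const.mul (ev _)).add (continuous_const.mul (ev _))).add
      (continuous_const.mul (ev _))
  exact (h.tendsto x).comp hu

/-- The bounded Jacobi operator on `ℓ²(ℤ)` with bounded real coefficients `a` (off-diagonal)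
and `b` (diagonal). -/
noncomputable def jacobi (a b : ℤ → ℝ) (ha : ∃ C, ∀ n, |a n| ≤ C)
    (hb : ∃ C, ∀ n, |b n| ≤ C) : ell2Z →L[ℂ] ell2Z :=
  ⟨jacobiLin a b ha hb, jacobiLin_continuous a b ha hb⟩

@[simp] theorem jacobi_apply (a b : ℤ → ℝ) (ha : ∃ C, ∀ n, |a n| ≤ C)
    (hb : ∃ C, ∀ n, |b n| ≤ C) (ψ : ell2Z) (n : ℤ) :
    jacobi a b ha hb ψ n =
      (a n : ℂ) * ψ (n + 1) + (a (n - 1) : ℂ) * ψ (n - 1) + (b n : ℂ) * ψ n := rfl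

/-- The Sturmian hopping sequence
`a(n) = (l₁ - l₂) (⌊(n+1)β⌋ - ⌊nβ⌋) + l₂`. -/
noncomputable def hop (l₁ l₂ β : ℝ) (n : ℤ) : ℝ :=
  (l₁ - l₂) * ((⌊((n : ℝ) + 1) * β⌋ - ⌊(n : ℝ) * β⌋ : ℤ) : ℝ) + l₂

theorem hop_bounded (l₁ l₂ β : ℝ) : ∃ C, ∀ n, |hop l₁ l₂ β n| ≤ C := by
  refine ⟨|l₁ - l₂| * (|β| + 1) + |l₂|, fun n => (abs_add_le _ _).trans ?_⟩
  rw [abs_mul]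
  gcongr
  rw [Int.cast_sub, abs_le]
  have h1 := Int.floor_le (((n : ℝ) + 1) * β)
  have h2 := Int.lt_floor_add_one (((n : ℝ) + 1) * β)
  have h3 := Int.floor_le ((n : ℝ) * β)
  have h4 := Int.lt_floor_add_one ((n : ℝ) * β)
  have h5 := neg_abs_le β
  have h6 := le_abs_self β
  constructor <;> nlinarith

/-- The off-diagonal Sturmian operator `H` (with `b = 0`). -/
noncomputable def sturmH (l₁ l₂ β : ℝ) : ell2Z →L[ℂ] ell2Z :=
  jacobi (hop l₁ l₂ β) (fun _ => 0) (hop_bounded l₁ l₂ β) ⟨0, fun _ => by simp⟩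

/-- `a(n,t) = |⟨e^{-itH} δ_1, δ_n⟩|²`, the probability to be at the site `n` at time `t`. -/
noncomputable def siteProb (H : ell2Z →L[ℂ] ell2Z) (n : ℤ) (t : ℝ) : ℝ :=
  ‖inner ℂ (NormedSpace.exp ((-(Complex.I * (t : ℂ))) • H) (delta 1)) (delta n)‖ ^ 2

/-- `⟨a(n,T)⟩ = (2/T) ∫_0^∞ e^{-2t/T} a(n,t) dt`. -/
noncomputable def avgSiteProb (H : ell2Z →L[ℂ] ell2Z) (n : ℤ) (T : ℝ) : ℝ :=
  2 / T * ∫ t in Set.Ioi (0 : ℝ), Real.exp (-2 * t / T) * siteProb H n t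

/-- The time-averaged outside probability `⟨P(N,T)⟩ = ∑_{|n| > N} ⟨a(n,T)⟩`. -/
noncomputable def avgOutsideProb (H : ell2Z →L[ℂ] ell2Z) (N : ℕ) (T : ℝ) : ℝ :=
  ∑' n : {n : ℤ // (N : ℤ) < |n|}, avgSiteProb H n T

/-- The one-step matrix `T_n(z) = (1/a(n)) (z, -1; a(n)², 0)`. -/
noncomputable def stepMatrix (a : ℤ → ℝ) (n : ℤ) (z : ℂ) : Matrix (Fin 2) (Fin 2) ℂ :=
  ((a n : ℂ)⁻¹) • !![z, -1; (a n : ℂ) ^ 2, 0]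

/-- The transfer matrix `F(n,z) = T_n(z) ⋯ T_1(z)`. -/
noncomputable def transfer (a : ℤ → ℝ) : ℕ → ℂ → Matrix (Fin 2) (Fin 2) ℂ
  | 0, _ => 1
  | n + 1, z => stepMatrix a ((n : ℤ) + 1) z * transfer a n z

/-- `‖F(n,z)‖`, the operator norm on `ℂ²` with its Euclidean norm. -/
noncomputable def transferNorm (a : ℤ → ℝ) (n : ℕ) (z : ℂ) : ℝ :=
  ‖Matrix.toEuclideanCLM (n := Fin 2) (𝕜 := ℂ) (transfer a n z)‖

/-- `max_{1 ≤ n ≤ N} ‖F(n,z)‖²`. -/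
noncomputable def maxTransferSq (a : ℤ → ℝ) (N : ℕ) (hN : 1 ≤ N) (z : ℂ) : ℝ :=
  (Finset.Icc 1 N).sup' (Finset.nonempty_Icc.2 hN) fun n => transferNorm a n z ^ 2

/-! The integrals and the sum above converge. -/

theorem jacobi_isSelfAdjoint (a b : ℤ → ℝ) (ha : ∃ C, ∀ n, |a n| ≤ C)
    (hb : ∃ C, ∀ n, |b n| ≤ C) : IsSelfAdjoint (jacobi a b ha hb) := by
  rw [ContinuousLinearMap.isSelfAdjoint_iff_isSymmetric]
  intro x y
  have summ : ∀ {f g : ℤ → ℂ}, Memℓp (E := fun _ : ℤ => ℂ) f 2 →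
      Memℓp (E := fun _ : ℤ => ℂ) g 2 → Summable fun i => g i * (starRingEnd ℂ) (f i) := by
    intro f g hf hg
    exact lp.summable_inner (𝕜 := ℂ) (⟨f, hf⟩ : ell2Z) (⟨g, hg⟩ : ell2Z)
  have ha' : ∃ C, ∀ n, |a (n - 1)| ≤ C := by
    obtain ⟨C, hC⟩ := ha
    exact ⟨C, fun n => hC _⟩
  have s1 := summ (memℓp_bdd_mul ha (memℓp_shift x 1)) (lp.memℓp y)
  have s2 := summ (memℓp_bdd_mul ha' (memℓp_shift x (-1))) (lp.memℓp y)
  have s3 := summ (memℓp_bdd_mul hb (lp.memℓp x)) (lp.memℓp y)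
  have t1 := summ (lp.memℓp x) (memℓp_bdd_mul ha (memℓp_shift y 1))
  have t2 := summ (lp.memℓp x) (memℓp_bdd_mul ha' (memℓp_shift y (-1)))
  have t3 := summ (lp.memℓp x) (memℓp_bdd_mul hb (lp.memℓp y))
  have e1 := (Equiv.addRight (1 : ℤ)).tsum_eq
    fun i => ((a (i - 1) : ℂ) * y (i + -1)) * (starRingEnd ℂ) (x i)
  have e2 := (Equiv.addRight (1 : ℤ)).tsum_eq
    fun i => y i * (starRingEnd ℂ) ((a (i - 1) : ℂ) * x (i + -1))
  change inner ℂ (jacobi a b ha hb x) y = inner ℂ x (jacobi a b ha hb y)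
  rw [lp.inner_eq_tsum, lp.inner_eq_tsum]
  calc ∑' i, inner ℂ (jacobi a b ha hb x i) (y i)
      = ∑' i, ((y i * (starRingEnd ℂ) ((a i : ℂ) * x (i + 1)) +
          y i * (starRingEnd ℂ) ((a (i - 1) : ℂ) * x (i + -1))) +
          y i * (starRingEnd ℂ) ((b i : ℂ) * x i)) := by
        refine tsum_congr fun i => ?_
        simp only [jacobi_apply, RCLike.inner_apply, map_add, ← sub_eq_add_neg]
        ring
    _ = ∑' i, ((((a i : ℂ) * y (i + 1)) * (starRingEnd ℂ) (x i) +
          ((a (i - 1) : ℂ) * y (i + -1)) * (starRingEnd ℂ) (x i)) +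
          ((b i : ℂ) * y i) * (starRingEnd ℂ) (x i)) := by
        rw [(s1.add s2).tsum_add s3, s1.tsum_add s2, (t1.add t2).tsum_add t3, t1.tsum_add t2,
          ← e1, ← e2, add_comm (∑' i, y i * (starRingEnd ℂ) ((a i : ℂ) * x (i + 1)))]
        congr 1
        · congr 1
          · refine tsum_congr fun i => ?_
            simp only [Equiv.coe_addRight, add_sub_cancel_right, add_neg_cancel_right, map_mul,
              Complex.conj_ofReal]
            ring
          · refine tsum_congr fun i => ?_
            simp only [Equiv.coe_addRight, add_sub_cancel_right, add_neg_cancel_right, map_mul,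
              Complex.conj_ofReal]
            ring
        · refine tsum_congr fun i => ?_
          simp only [map_mul, Complex.conj_ofReal]
          ring
    _ = ∑' i, inner ℂ (x i) (jacobi a b ha hb y i) := by
        refine tsum_congr fun i => ?_
        simp only [jacobi_apply, RCLike.inner_apply, ← sub_eq_add_neg]
        ring

theorem sturmH_isSelfAdjoint (l₁ l₂ β : ℝ) : IsSelfAdjoint (sturmH l₁ l₂ β) :=
  jacobi_isSelfAdjoint _ _ _ _

theorem siteProb_continuous (H : ell2Z →L[ℂ] ell2Z) (n : ℤ) : Continuous (siteProb H n) := by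
  unfold siteProb
  let _ : NormedAlgebra ℚ (ell2Z →L[ℂ] ell2Z) := NormedAlgebra.restrictScalars ℚ ℂ _
  have h : Continuous fun t : ℝ => NormedSpace.exp ((-(Complex.I * (t : ℂ))) • H) :=
    NormedSpace.exp_continuous.comp (by fun_prop)
  have h2 : Continuous fun t : ℝ =>
      NormedSpace.exp ((-(Complex.I * (t : ℂ))) • H) (delta 1) := h.clm_apply continuous_const
  exact ((h2.inner continuous_const).norm).pow 2

theorem siteProb_eq (H : ell2Z →L[ℂ] ell2Z) (n : ℤ) (t : ℝ) : siteProb H n t =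
    ‖(NormedSpace.exp ((-(Complex.I * (t : ℂ))) • H) (delta 1) : ell2Z) n‖ ^ 2 := by
  unfold siteProb
  rw [delta, delta, lp.inner_single_right]
  simp

theorem siteProb_hasSum {H : ell2Z →L[ℂ] ell2Z} (hH : IsSelfAdjoint H) (t : ℝ) :
    HasSum (fun n => siteProb H n t) 1 := by
  have hmem : NormedSpace.exp ((-(Complex.I * (t : ℂ))) • H) ∈ unitary (ell2Z →L[ℂ] ell2Z) := by
    let _ : NormedAlgebra ℚ (ell2Z →L[ℂ] ell2Z) := NormedAlgebra.restrictScalars ℚ ℂ _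
    refine NormedSpace.exp_mem_unitary_of_mem_skewAdjoint ?_
    exact hH.smul_mem_skewAdjoint (by simp [skewAdjoint.mem_iff])
  have hn : ‖NormedSpace.exp ((-(Complex.I * (t : ℂ))) • H) (delta 1)‖ = 1 := by
    rw [ContinuousLinearMap.norm_map_of_mem_unitary hmem, delta, lp.norm_single (by norm_num)]
    simp
  have h := lp.hasSum_norm (by norm_num : 0 < (2 : ℝ≥0∞).toReal)
    (NormedSpace.exp ((-(Complex.I * (t : ℂ))) • H) (delta 1))
  rw [hn] at h
  simp only [siteProb_eq]
  simpa using h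

theorem siteProb_integrableOn {H : ell2Z →L[ℂ] ell2Z} (hH : IsSelfAdjoint H) (n : ℤ) {T : ℝ}
    (hT : 0 < T) : MeasureTheory.IntegrableOn
      (fun t => Real.exp (-2 * t / T) * siteProb H n t) (Set.Ioi 0) := by
  have h0 : MeasureTheory.IntegrableOn (fun t => Real.exp (-(2 / T) * t)) (Set.Ioi (0 : ℝ)) :=
    exp_neg_integrableOn_Ioi 0 (by positivity)
  have hc := siteProb_continuous H n
  refine MeasureTheory.Integrable.mono' h0
    (Continuous.aestronglyMeasurable (by fun_prop)) (Filter.Eventually.of_forall fun t => ?_)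
  have h1 : siteProb H n t ≤ 1 :=
    le_hasSum (siteProb_hasSum hH t) n fun m _ => by unfold siteProb; positivity
  have h2 : 0 ≤ siteProb H n t := by unfold siteProb; positivity
  rw [Real.norm_eq_abs, abs_of_nonneg (by positivity), show -2 * t / T = -(2 / T) * t by ring]
  exact mul_le_of_le_one_right (by positivity) h1

theorem avgSiteProb_summable {H : ell2Z →L[ℂ] ell2Z} (hH : IsSelfAdjoint H) {T : ℝ}
    (hT : 0 < T) : Summable fun n => avgSiteProb H n T := by
  have h0 : MeasureTheory.IntegrableOn (fun t => Real.exp (-2 * t / T)) (Set.Ioi (0 : ℝ)) := by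
    have := exp_neg_integrableOn_Ioi 0 (show 0 < 2 / T by positivity)
    refine this.congr_fun (fun t _ => ?_) measurableSet_Ioi
    change Real.exp (-(2 / T) * t) = Real.exp (-2 * t / T)
    congr 1
    ring
  have hp : ∀ n t, 0 ≤ siteProb H n t := fun n t => by unfold siteProb; positivity
  refine Summable.mul_left _ (summable_of_sum_le
    (c := ∫ t in Set.Ioi (0 : ℝ), Real.exp (-2 * t / T))
    (fun n => MeasureTheory.integral_nonneg fun t => mul_nonneg (Real.exp_pos _).le (hp n t))
    fun s => ?_)
  rw [← MeasureTheory.integral_finsetSum _ fun n _ => siteProb_integrableOn hH n hT]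
  refine MeasureTheory.integral_mono
    (MeasureTheory.integrable_finsetSum _ fun n _ => siteProb_integrableOn hH n hT) h0 fun t => ?_
  simp only [← Finset.mul_sum]
  exact mul_le_of_le_one_right (Real.exp_pos _).le
    (sum_le_hasSum s (fun n _ => hp n t) (siteProb_hasSum hH t))

end OffDiagSturm

/-! ### Plancherel's identity on `L¹ ∩ L²` -/

namespace OffDiagSturm

open MeasureTheory FourierTransform

/-! The resolvent is the Laplace transform of the evolution, so Plancherel gives `⟨a(n,T)⟩ =
(1/(πT)) ∫ |u(n)|² dE`, where `u = (z - H)⁻¹ δ₁` and `z = E + i/T`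
(`avgSiteProb_eq_integral_resolvent`). It remains to bound `∑_{|n|>N} |u(n)|²` at each energy.

If `|z| ≥ K`, then `z` is far from the spectrum. Since `H` only couples neighbours, `u(n) = z⁻ᵐ (Hᵐ
u)(n)` for `m ≤ |n - 1|`, and `‖H‖ ≤ K - 1` yields the factor `((K-1)/K)^(2N)/|z|²`
(`sum_norm_resolvent_sq_le`). Its integral over all energies contributes `e^{-cN}`.

Otherwise let `ε = Im z = 1/T`. On a half-line `u` is a square summable solution, whose current at a
site is `ε` times its squared tail. A column of `F(n,z)` is a solution with zero initial current, so
its current is `-ε` times its squared partial sum. The two currents have opposite signs, and the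
conserved Wronskian of the two solutions dominates them: tail times `‖F(n,z)‖²` is at most a
constant times `ε⁻²` times the initial data of `u` (`IsSolution.tail_mul_le`). These data are
`O(ε⁻²)`, which gives `T⁴`, and the factor `1/(πT)` leaves `T³`. The left half-line needs no new
matrices, because the Sturmian sequence is reflection symmetric (`hop_reflect`). -/

/-- For an integrable and square integrable function the Fourier integral represents the
`L²` Fourier transform. -/
theorem fourier_toLp_ae_eq {f : ℝ → ℂ} (hf : Integrable f) (hf2 : MemLp f 2) :
    (𝓕 (hf2.toLp f) : Lp ℂ 2 (volume : Measure ℝ)) =ᵐ[volume] 𝓕 f := by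
  have hcont : Continuous (𝓕 f) :=
    VectorFourier.fourierIntegral_continuous Real.continuous_fourierChar
      (by exact continuous_inner) hf
  refine ae_eq_of_integral_contDiff_smul_eq ((Lp.memLp _).locallyIntegrable (by norm_num))
    hcont.locallyIntegrable fun g hg hgc => ?_
  have hg₁ : HasCompactSupport (Complex.ofRealCLM ∘ g) := hgc.comp_left rfl
  have hg₂ : ContDiff ℝ ((⊤ : ℕ∞) : WithTop ℕ∞) (Complex.ofRealCLM ∘ g) :=
    Complex.ofRealCLM.contDiff.comp hg
  -- The two transforms are compared by pairing with `φ`: both pairings move the transform onto `φ`,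
  -- one by duality of tempered distributions, the other by Fubini.
  set φ := hg₁.toSchwartzMap hg₂ with hφ
  have h1 : (𝓕 (Lp.toTemperedDistribution (hf2.toLp f))) φ =
      Lp.toTemperedDistribution (𝓕 (hf2.toLp f)) φ := by
    rw [Lp.fourier_toTemperedDistribution_eq]
  rw [TemperedDistribution.fourier_apply, Lp.toTemperedDistribution_apply,
    Lp.toTemperedDistribution_apply] at h1
  have h2 : ∫ x, (𝓕 φ) x • (hf2.toLp f) x = ∫ x, (𝓕 (φ : ℝ → ℂ)) x • f x := by
    refine integral_congr_ae ?_
    filter_upwards [hf2.coeFn_toLp] with x hx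
    rw [hx, SchwartzMap.fourier_coe]
  have h3 : ∫ x, (𝓕 (φ : ℝ → ℂ)) x • f x = ∫ x, φ x • 𝓕 f x := by
    simpa using! (VectorFourier.integral_fourierIntegral_smul_eq_flip (L := innerₗ ℝ)
      Real.continuous_fourierChar continuous_inner φ.integrable hf)
  have e : ∀ h : ℝ → ℂ, ∫ x, g x • h x = ∫ x, φ x • h x := fun h => by
    refine integral_congr_ae (.of_forall fun x => ?_)
    simp [hφ]
  rw [e, e, ← h1, h2, h3]

theorem memLp_fourier {f : ℝ → ℂ} (hf : Integrable f) (hf2 : MemLp f 2) :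
    MemLp (𝓕 f) 2 :=
  (memLp_congr_ae (fourier_toLp_ae_eq hf hf2)).1 (Lp.memLp _)

/-- Plancherel's identity for the Fourier integral on `L¹ ∩ L²`. -/
theorem integral_norm_sq_fourier {f : ℝ → ℂ} (hf : Integrable f) (hf2 : MemLp f 2) :
    ∫ ξ, ‖𝓕 f ξ‖ ^ 2 = ∫ t, ‖f t‖ ^ 2 := by
  have key : ∀ h : Lp ℂ 2 (volume : Measure ℝ), ‖h‖ ^ 2 = ∫ x, ‖h x‖ ^ 2 := fun h => by
    have := @inner_self_eq_norm_sq ℂ _ _ _ _ h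
    rw [← this, L2.inner_def, ← integral_re (L2.integrable_inner h h)]
    simp [← Complex.ofReal_pow]
  have h1 := key (𝓕 (hf2.toLp f))
  rw [Lp.norm_fourier_eq, key] at h1
  calc ∫ ξ, ‖𝓕 f ξ‖ ^ 2 = ∫ ξ, ‖(𝓕 (hf2.toLp f) : Lp ℂ 2 (volume : Measure ℝ)) ξ‖ ^ 2 := by
        refine integral_congr_ae ?_
        filter_upwards [fourier_toLp_ae_eq hf hf2] with x hx
        rw [hx]
    _ = ∫ t, ‖hf2.toLp f t‖ ^ 2 := h1.symm
    _ = ∫ t, ‖f t‖ ^ 2 := by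
        refine integral_congr_ae ?_
        filter_upwards [hf2.coeFn_toLp] with x hx
        rw [hx]

end OffDiagSturm

/-! ### Half-line solutions: Wronskian, current and transfer matrices -/

namespace OffDiagSturm

/-- The pair `(p n, q n) = (w (n + 1), a n * w n)` of a solution `w` of the half-line
difference equation; `a n` here stands for the hopping amplitude between `n + 1` and `n + 2`. -/
def IsSolution (a : ℕ → ℝ) (z : ℂ) (p q : ℕ → ℂ) : Prop :=
  ∀ n, q (n + 1) = a n * p n ∧ (a n : ℂ) * p (n + 1) + q n = z * p n

variable {a : ℕ → ℝ} {z : ℂ} {p q P Q : ℕ → ℂ}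

theorem IsSolution.wronskian (h : IsSolution a z p q) (H : IsSolution a z P Q) (n : ℕ) :
    P n * q n - Q n * p n = P 0 * q 0 - Q 0 * p 0 := by
  induction n with
  | zero => rfl
  | succ n ih =>
    rw [← ih, (h n).1, (H n).1]
    linear_combination p n * (H n).2 - P n * (h n).2

theorem IsSolution.current_succ (h : IsSolution a z p q) (n : ℕ) :
    (q n * starRingEnd ℂ (p n)).im =
      (q (n + 1) * starRingEnd ℂ (p (n + 1))).im + z.im * ‖p n‖ ^ 2 := by
  have e : q n = z * p n - a n * p (n + 1) := by linear_combination (h n).2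
  rw [e, (h n).1, ← Complex.normSq_eq_norm_sq, Complex.normSq_apply]
  simp
  ring

theorem IsSolution.current_eq_sum (h : IsSolution a z p q) (n : ℕ) :
    (q 0 * starRingEnd ℂ (p 0)).im =
      (q n * starRingEnd ℂ (p n)).im + z.im * ∑ k ∈ Finset.range n, ‖p k‖ ^ 2 := by
  induction n with
  | zero => simp
  | succ n ih =>
    rw [ih, h.current_succ n, Finset.sum_range_succ]
    ring

theorem IsSolution.shift (h : IsSolution a z p q) (n : ℕ) :
    IsSolution (fun k => a (k + n)) z (fun k => p (k + n)) (fun k => q (k + n)) := fun k => by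
  have := h (k + n)
  rw [add_right_comm] at this
  exact this

open Filter Topology in
-- Current conservation with loss `z.im * ‖p k‖ ^ 2` at each site. The boundary term at infinity
-- vanishes because `p` tends to zero and `a` is bounded.
theorem IsSolution.current_eq_tsum (h : IsSolution a z p q) {L : ℝ} (ha : ∀ n, |a n| ≤ L)
    (hp : Summable fun k => ‖p k‖ ^ 2) (n : ℕ) :
    (q n * starRingEnd ℂ (p n)).im = z.im * ∑' k, ‖p (k + n)‖ ^ 2 := by
  have hp0 : Tendsto (fun k => ‖p k‖) atTop (𝓝 0) := by
    have := hp.tendsto_atTop_zero.sqrt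
    simpa using this
  have hJ : Tendsto (fun k => (q (k + 1) * starRingEnd ℂ (p (k + 1))).im) atTop (𝓝 0) := by
    have hb : Tendsto (fun k => L * (‖p k‖ * ‖p (k + 1)‖)) atTop (𝓝 0) := by
      simpa using (hp0.mul (hp0.comp (tendsto_add_atTop_nat 1))).const_mul L
    refine squeeze_zero_norm (fun k => ?_) hb
    refine (Complex.abs_im_le_norm _).trans ?_
    rw [(h k).1, norm_mul, norm_mul, Complex.norm_real, RCLike.norm_conj, mul_assoc]
    exact mul_le_mul_of_nonneg_right (ha k) (by positivity)
  have hJ' : Tendsto (fun k => (q (k + n) * starRingEnd ℂ (p (k + n))).im) atTop (𝓝 0) :=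
    (tendsto_add_atTop_iff_nat (f := fun k => (q k * starRingEnd ℂ (p k)).im) n).2
      ((tendsto_add_atTop_iff_nat 1).1 hJ)
  have hs := (((summable_nat_add_iff n).2 hp).hasSum.tendsto_sum_nat).const_mul z.im
  have := hJ'.add hs
  rw [zero_add] at this
  refine tendsto_nhds_unique (tendsto_const_nhds.congr fun k => ?_) this
  simpa using (h.shift n).current_eq_sum k

/-- The difference of the two sides is exactly `‖X ȳ - Y x̄‖²`. -/
theorem norm_sq_wronskian (x y X Y : ℂ) :
    -4 * (Y * starRingEnd ℂ X).im * (y * starRingEnd ℂ x).im ≤ ‖X * y - Y * x‖ ^ 2 := by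
  have h := sq_nonneg ‖X * starRingEnd ℂ y - Y * starRingEnd ℂ x‖
  rw [← Complex.normSq_eq_norm_sq, Complex.normSq_apply] at h ⊢
  simp at h ⊢
  linarith

/-- The left side is the imaginary part of `(X y - Y x) X̄ x̄`. -/
theorem im_wronskian_mul (x y X Y : ℂ) :
    ‖X‖ ^ 2 * (y * starRingEnd ℂ x).im - ‖x‖ ^ 2 * (Y * starRingEnd ℂ X).im ≤
      ‖X * y - Y * x‖ * (‖X‖ * ‖x‖) := by
  have h := Complex.im_le_norm ((X * y - Y * x) * (starRingEnd ℂ X * starRingEnd ℂ x))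
  rw [norm_mul, norm_mul, RCLike.norm_conj, RCLike.norm_conj] at h
  refine le_trans (le_of_eq ?_) h
  rw [← Complex.normSq_eq_norm_sq, ← Complex.normSq_eq_norm_sq, Complex.normSq_apply,
    Complex.normSq_apply]
  simp
  ring

/-- The tail of a square summable solution is small where another solution, with vanishing
current at the origin, is large. -/
theorem IsSolution.tail_mul_le (h : IsSolution a z p q) (H : IsSolution a z P Q) {L : ℝ}
    (ha : ∀ n, |a n| ≤ L) (hp : Summable fun k => ‖p k‖ ^ 2)
    (hz : 0 < z.im) (h0 : (Q 0 * starRingEnd ℂ (P 0)).im = 0) (n : ℕ) :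
    (∑' k, ‖p (k + (n + 1))‖ ^ 2) * (‖P (n + 1)‖ ^ 2 + ‖Q (n + 1)‖ ^ 2) ≤
      ‖P 0 * q 0 - Q 0 * p 0‖ ^ 2 / z.im ^ 2 * (1 + L ^ 2) := by
  have hJ := h.current_eq_tsum ha hp (n + 1)
  have hK := H.current_eq_sum (n + 1)
  rw [h0] at hK
  have hw := norm_sq_wronskian (p (n + 1)) (q (n + 1)) (P (n + 1)) (Q (n + 1))
  have hi := im_wronskian_mul (p (n + 1)) (q (n + 1)) (P (n + 1)) (Q (n + 1))
  rw [h.wronskian H] at hw hi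
  have hX : ‖p (n + 1)‖ ^ 2 ≤ ∑' k, ‖p (k + (n + 1))‖ ^ 2 := by
    have := ((summable_nat_add_iff (n + 1)).2 hp).le_tsum 0 fun k _ => sq_nonneg _
    simpa using this
  have hY : ‖P n‖ ^ 2 ≤ ∑ k ∈ Finset.range (n + 1), ‖P k‖ ^ 2 :=
    Finset.single_le_sum (f := fun k => ‖P k‖ ^ 2) (fun k _ => sq_nonneg _) (by simp)
  have hQ : ‖Q (n + 1)‖ ^ 2 ≤ L ^ 2 * ‖P n‖ ^ 2 := by
    rw [(H n).1, norm_mul, mul_pow, Complex.norm_real, Real.norm_eq_abs]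
    have := ha n
    gcongr
  set X := ∑' k, ‖p (k + (n + 1))‖ ^ 2
  set Y := ∑ k ∈ Finset.range (n + 1), ‖P k‖ ^ 2
  set W := ‖P 0 * q 0 - Q 0 * p 0‖
  set ε := z.im
  -- The vanishing initial current enters here: the currents are now `ε X` and `-ε Y`, so both terms
  -- on the left of `hi` are nonnegative.
  have hK' : (Q (n + 1) * starRingEnd ℂ (P (n + 1))).im = -(ε * Y) := by linarith
  rw [hJ, hK'] at hw hi
  have hX0 : 0 ≤ X := (sq_nonneg _).trans hX
  have hY0 : 0 ≤ Y := (sq_nonneg _).trans hY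
  have hW0 : 0 ≤ W := norm_nonneg _
  -- `hw` reads `4 ε² X Y ≤ W²`, and `Q (n + 1) = a n * P n` is controlled by the partial sum `Y`.
  have h1 : X * ‖Q (n + 1)‖ ^ 2 ≤ W ^ 2 / ε ^ 2 * L ^ 2 := by
    have : X * Y ≤ W ^ 2 / ε ^ 2 := by
      rw [le_div_iff₀ (by positivity)]
      nlinarith [mul_nonneg (mul_nonneg hX0 hY0) (sq_nonneg ε)]
    calc X * ‖Q (n + 1)‖ ^ 2 ≤ X * (L ^ 2 * Y) := by gcongr; exact hQ.trans (by gcongr)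
      _ = X * Y * L ^ 2 := by ring
      _ ≤ _ := by gcongr
  -- `Y` stops before `P (n + 1)`, so `hi` is used instead. It gives `ε A² X ≤ W A b` with `b² ≤ X`;
  -- squaring and cancelling `A² X` leaves the claim.
  have h2 : X * ‖P (n + 1)‖ ^ 2 ≤ W ^ 2 / ε ^ 2 := by
    rw [le_div_iff₀ (by positivity)]
    set A := ‖P (n + 1)‖
    set b := ‖p (n + 1)‖
    have hA : 0 ≤ A := norm_nonneg _
    have hb : 0 ≤ b := norm_nonneg _
    have h3 : ε * (A ^ 2 * X) ≤ W * (A * b) := by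
      nlinarith [mul_nonneg (mul_nonneg hz.le hY0) (sq_nonneg b)]
    rcases (mul_nonneg (sq_nonneg A) hX0).eq_or_lt with h4 | h4
    · nlinarith [sq_nonneg W]
    · have h5 : (ε * (A ^ 2 * X)) ^ 2 ≤ (W * (A * b)) ^ 2 := by gcongr
      have h6 : (W * (A * b)) ^ 2 ≤ W ^ 2 * (A ^ 2 * X) := by
        calc (W * (A * b)) ^ 2 = W ^ 2 * (A ^ 2 * b ^ 2) := by ring
          _ ≤ _ := by gcongr
      refine le_of_mul_le_mul_right ?_ h4
      nlinarith
  calc _ = X * ‖P (n + 1)‖ ^ 2 + X * ‖Q (n + 1)‖ ^ 2 := by ring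
    _ ≤ W ^ 2 / ε ^ 2 + W ^ 2 / ε ^ 2 * L ^ 2 := add_le_add h2 h1
    _ = _ := by ring

theorem transfer_isSolution {a : ℤ → ℝ} (ha : ∀ n, a n ≠ 0) (z : ℂ) (j : Fin 2) :
    IsSolution (fun n => a (n + 1)) z (fun n => transfer a n z 0 j)
      (fun n => transfer a n z 1 j) := fun n => by
  have h : (a (n + 1) : ℂ) ≠ 0 := by exact_mod_cast ha _
  constructor
  · simp [transfer, stepMatrix, Matrix.mul_apply, Fin.sum_univ_two]
    left
    field_simp
  · simp [transfer, stepMatrix, Matrix.mul_apply, Fin.sum_univ_two]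
    field_simp
    ring

theorem norm_toEuclideanCLM_sq_le (M : Matrix (Fin 2) (Fin 2) ℂ) :
    ‖Matrix.toEuclideanCLM (n := Fin 2) (𝕜 := ℂ) M‖ ^ 2 ≤
      (‖M 0 0‖ ^ 2 + ‖M 1 0‖ ^ 2) + (‖M 0 1‖ ^ 2 + ‖M 1 1‖ ^ 2) := by
  rw [← Real.le_sqrt (norm_nonneg _) (by positivity)]
  refine ContinuousLinearMap.opNorm_le_bound _ (Real.sqrt_nonneg _) fun x => ?_
  rw [EuclideanSpace.norm_eq, EuclideanSpace.norm_eq, ← Real.sqrt_mul (by positivity)]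
  refine Real.sqrt_le_sqrt ?_
  have key : ∀ s t u v : ℂ, ‖s * u + t * v‖ ^ 2 ≤
      (‖s‖ ^ 2 + ‖t‖ ^ 2) * (‖u‖ ^ 2 + ‖v‖ ^ 2) := fun s t u v => by
    have h : ‖s * u + t * v‖ ≤ ‖s‖ * ‖u‖ + ‖t‖ * ‖v‖ :=
      (norm_add_le _ _).trans (by simp)
    have h' : ‖s * u + t * v‖ ^ 2 ≤ (‖s‖ * ‖u‖ + ‖t‖ * ‖v‖) ^ 2 := by gcongr
    nlinarith [sq_nonneg (‖s‖ * ‖v‖ - ‖t‖ * ‖u‖)]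
  have k0 := key (M 0 0) (M 0 1) (x 0) (x 1)
  have k1 := key (M 1 0) (M 1 1) (x 0) (x 1)
  simp only [Fin.sum_univ_two, Matrix.ofLp_toEuclideanCLM, Matrix.mulVec, dotProduct]
  linarith

/-- The tail of a square summable half-line solution is controlled by the norm of the transfer
matrix. -/
theorem IsSolution.tail_mul_transferNorm_le {a : ℤ → ℝ} (ha : ∀ n, a n ≠ 0) {L : ℝ}
    (hL : ∀ n, |a n| ≤ L) (h : IsSolution (fun n => a (n + 1)) z p q)
    (hp : Summable fun k => ‖p k‖ ^ 2) (hz : 0 < z.im) {n : ℕ} (hn : 1 ≤ n) :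
    (∑' k, ‖p (k + n)‖ ^ 2) * transferNorm a n z ^ 2 ≤
      (‖p 0‖ ^ 2 + ‖q 0‖ ^ 2) / z.im ^ 2 * (1 + L ^ 2) := by
  obtain ⟨n, rfl⟩ : ∃ m, n = m + 1 := ⟨n - 1, by omega⟩
  have h0 := h.tail_mul_le (transfer_isSolution ha z 0) (fun n => hL _) hp hz
    (by simp [transfer]) n
  have h1 := h.tail_mul_le (transfer_isSolution ha z 1) (fun n => hL _) hp hz
    (by simp [transfer]) n
  -- The columns start at `(1, 0)` and `(0, 1)`, so their Wronskians with `(p, q)` are `q 0` and `-p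
  -- 0`.
  simp only [transfer, Matrix.one_apply_eq] at h0 h1
  simp at h0 h1
  have hF : transferNorm a (n + 1) z ^ 2 ≤ _ := norm_toEuclideanCLM_sq_le _
  have hX : 0 ≤ ∑' k, ‖p (k + (n + 1))‖ ^ 2 := tsum_nonneg fun _ => sq_nonneg _
  refine (mul_le_mul_of_nonneg_left hF hX).trans ?_
  rw [mul_add, add_div, add_mul, add_comm (‖p 0‖ ^ 2 / _ * _)]
  exact add_le_add h0 h1

end OffDiagSturm

/-! ### Resolvent, evolution and Parseval's identity -/

namespace OffDiagSturm

open MeasureTheory FourierTransform Filter Topology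

section Resolvent

variable {H : ell2Z →L[ℂ] ell2Z}

theorem isUnit_algebraMap_sub (hH : IsSelfAdjoint H) {z : ℂ} (hz : z.im ≠ 0) :
    IsUnit (algebraMap ℂ (ell2Z →L[ℂ] ell2Z) z - H) := by
  by_contra h
  exact hz (hH.im_eq_zero_of_mem_spectrum (spectrum.mem_iff.2 h))

theorem sub_apply_resolvent (hH : IsSelfAdjoint H) {z : ℂ} (hz : z.im ≠ 0) (x : ell2Z) :
    z • resolvent H z x - H (resolvent H z x) = x := by
  have h := Ring.mul_inverse_cancel _ (isUnit_algebraMap_sub hH hz)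
  have := congrArg (fun A : ell2Z →L[ℂ] ell2Z => A x) h
  simpa [resolvent, Algebra.algebraMap_eq_smul_one] using this

theorem resolvent_apply_sub (hH : IsSelfAdjoint H) {z : ℂ} (hz : z.im ≠ 0) (x : ell2Z) :
    z • resolvent H z x - resolvent H z (H x) = x := by
  have h := Ring.inverse_mul_cancel _ (isUnit_algebraMap_sub hH hz)
  have := congrArg (fun A : ell2Z →L[ℂ] ell2Z => A x) h
  simpa [resolvent, Algebra.algebraMap_eq_smul_one] using this

/-- Self-adjointness makes `⟨x, H x⟩` real, so `Im ⟨x, (z - H) x⟩ = z.im * ‖x‖ ^ 2`; then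
Cauchy–Schwarz. -/
theorem im_mul_norm_le (hH : IsSelfAdjoint H) (z : ℂ) (x : ell2Z) :
    z.im * ‖x‖ ≤ ‖z • x - H x‖ := by
  rcases eq_or_ne x 0 with rfl | hx
  · simp
  have hx' : 0 < ‖x‖ := norm_pos_iff.2 hx
  have hs : (inner ℂ x (H x)).im = 0 := by
    have h := (ContinuousLinearMap.isSelfAdjoint_iff_isSymmetric.1 hH) x x
    have h2 := inner_conj_symm (𝕜 := ℂ) x (H x)
    rw [ContinuousLinearMap.coe_coe] at h
    rw [h] at h2
    exact Complex.conj_eq_iff_im.1 h2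
  have h3 : (inner ℂ x (z • x - H x)).im = z.im * ‖x‖ ^ 2 := by
    rw [inner_sub_right, inner_smul_right, inner_self_eq_norm_sq_to_K, Complex.sub_im, hs]
    simp [← Complex.ofReal_pow]
  have h4 := (Complex.im_le_norm _).trans (norm_inner_le_norm (𝕜 := ℂ) x (z • x - H x))
  rw [h3] at h4
  refine le_of_mul_le_mul_right ?_ hx'
  linarith

theorem norm_delta (n : ℤ) : ‖delta n‖ = 1 := by
  rw [delta, lp.norm_single (by norm_num)]
  simp

theorem norm_resolvent_delta_le (hH : IsSelfAdjoint H) {z : ℂ} (hz : 0 < z.im) (n : ℤ) :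
    ‖resolvent H z (delta n)‖ ≤ 1 / z.im := by
  have h := im_mul_norm_le hH z (resolvent H z (delta n))
  rw [sub_apply_resolvent hH hz.ne', norm_delta] at h
  rw [le_div_iff₀ hz]
  linarith

theorem norm_evolution_delta (hH : IsSelfAdjoint H) (t : ℝ) :
    ‖NormedSpace.exp ((-(Complex.I * (t : ℂ))) • H) (delta 1)‖ = 1 := by
  have hmem : NormedSpace.exp ((-(Complex.I * (t : ℂ))) • H) ∈ unitary (ell2Z →L[ℂ] ell2Z) := by
    let _ : NormedAlgebra ℚ (ell2Z →L[ℂ] ell2Z) := NormedAlgebra.restrictScalars ℚ ℂ _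
    refine NormedSpace.exp_mem_unitary_of_mem_skewAdjoint ?_
    exact hH.smul_mem_skewAdjoint (by simp [skewAdjoint.mem_iff])
  rw [ContinuousLinearMap.norm_map_of_mem_unitary hmem, norm_delta]

theorem hasDerivAt_evolution (H : ell2Z →L[ℂ] ell2Z) (x : ell2Z) (t : ℝ) :
    HasDerivAt (fun t : ℝ => NormedSpace.exp ((-(Complex.I * (t : ℂ))) • H) x)
      (-Complex.I • H (NormedSpace.exp ((-(Complex.I * (t : ℂ))) • H) x)) t := by
  have e : ∀ t : ℝ, (-(Complex.I * (t : ℂ))) • H = t • (-Complex.I • H) := fun t => by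
    change _ = (t : ℂ) • (-Complex.I • H)
    rw [smul_smul]
    congr 1
    ring
  have h := hasDerivAt_exp_smul_const' (𝕂 := ℝ) (-Complex.I • H) t
  have h2 := ((ContinuousLinearMap.apply ℂ ell2Z x).restrictScalars ℝ).hasFDerivAt.comp_hasDerivAt
    t h
  simp only [e]
  convert! h2 using 1

theorem continuous_evolution (H : ell2Z →L[ℂ] ell2Z) (x : ell2Z) :
    Continuous fun t : ℝ => NormedSpace.exp ((-(Complex.I * (t : ℂ))) • H) x :=
  continuous_iff_continuousAt.2 fun t => (hasDerivAt_evolution H x t).continuousAt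

theorem norm_evolution_apply_le (hH : IsSelfAdjoint H) (n : ℤ) (t : ℝ) :
    ‖(NormedSpace.exp ((-(Complex.I * (t : ℂ))) • H) (delta 1) : ell2Z) n‖ ≤ 1 :=
  (lp.norm_apply_le_norm (by norm_num) _ n).trans (norm_evolution_delta hH t).le

theorem norm_cexp_I_mul (z : ℂ) (t : ℝ) :
    ‖Complex.exp (Complex.I * z * t)‖ = Real.exp (-z.im * t) := by
  rw [Complex.norm_exp]
  simp

/-- Evaluation at a site, as a continuous linear functional. -/
noncomputable def evalCLM (n : ℤ) : ell2Z →L[ℂ] ℂ := innerSL ℂ (delta n)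

theorem evalCLM_apply (n : ℤ) (x : ell2Z) : evalCLM n x = x n := by
  rw [evalCLM, innerSL_apply_apply, delta, lp.inner_single_left]
  simp

theorem continuous_evolution_apply (H : ell2Z →L[ℂ] ell2Z) (n : ℤ) :
    Continuous fun t : ℝ =>
      (NormedSpace.exp ((-(Complex.I * (t : ℂ))) • H) (delta 1) : ell2Z) n := by
  simp only [← evalCLM_apply]
  exact (evalCLM n).continuous.comp (continuous_evolution H _)

theorem integrableOn_cexp_mul_evolution (hH : IsSelfAdjoint H) {z : ℂ} (hz : 0 < z.im) (n : ℤ) :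
    IntegrableOn (fun t : ℝ => Complex.exp (Complex.I * z * t) *
      (NormedSpace.exp ((-(Complex.I * (t : ℂ))) • H) (delta 1) : ell2Z) n) (Set.Ioi 0) := by
  refine Integrable.mono' (exp_neg_integrableOn_Ioi 0 hz) ?_ (.of_forall fun t => ?_)
  · have := continuous_evolution_apply H n
    exact Continuous.aestronglyMeasurable (by fun_prop)
  · rw [norm_mul, norm_cexp_I_mul]
    exact mul_le_of_le_one_right (Real.exp_pos _).le (norm_evolution_apply_le hH n t)

/-- The resolvent is the Laplace transform of the evolution. -/
theorem integral_cexp_mul_evolution (hH : IsSelfAdjoint H) {z : ℂ} (hz : 0 < z.im) (n : ℤ) :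
    ∫ t in Set.Ioi (0 : ℝ), Complex.exp (Complex.I * z * t) *
      (NormedSpace.exp ((-(Complex.I * (t : ℂ))) • H) (delta 1) : ell2Z) n =
      Complex.I * (resolvent H z (delta 1)) n := by
  set ψ : ℝ → ell2Z := fun t => NormedSpace.exp ((-(Complex.I * (t : ℂ))) • H) (delta 1) with hψ
  set R := resolvent H z with hR
  -- `e^{izt} R ψ(t)` is a primitive of `i e^{izt} ψ(t)`, since `z R - R H = 1`.
  have hd : ∀ t ∈ Set.Ici (0 : ℝ), HasDerivAt
      (fun t : ℝ => Complex.exp (Complex.I * z * t) * evalCLM n (R (ψ t)))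
      (Complex.I * (Complex.exp (Complex.I * z * t) * ψ t n)) t := fun t _ => by
    have h1 : HasDerivAt (fun t : ℝ => evalCLM n (R (ψ t)))
        (evalCLM n (R (-Complex.I • H (ψ t)))) t :=
      (((evalCLM n).comp R).restrictScalars ℝ).hasFDerivAt.comp_hasDerivAt t
        (hasDerivAt_evolution H (delta 1) t)
    have h2 : HasDerivAt (fun t : ℝ => Complex.exp (Complex.I * z * t))
        (Complex.exp (Complex.I * z * t) * (Complex.I * z)) t := by
      have := ((hasDerivAt_id (t : ℂ)).const_mul (Complex.I * z)).cexp.comp_ofReal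
      simpa using this
    convert! h2.mul h1 using 1
    have h3 := congrArg (evalCLM n) (resolvent_apply_sub hH hz.ne' (ψ t))
    rw [map_sub, map_smul, smul_eq_mul] at h3
    rw [map_smul, map_smul, smul_eq_mul, ← evalCLM_apply, ← h3]
    ring
  have hlim : Tendsto (fun t : ℝ => Complex.exp (Complex.I * z * t) * evalCLM n (R (ψ t)))
      atTop (𝓝 0) := by
    have h0 : Tendsto (fun t : ℝ => Real.exp (-z.im * t) * (‖(evalCLM n).comp R‖ * 1))
        atTop (𝓝 0) := by
      have : Tendsto (fun t : ℝ => Real.exp (-z.im * t)) atTop (𝓝 0) :=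
        Real.tendsto_exp_atBot.comp (tendsto_id.const_mul_atTop_of_neg (by linarith))
      simpa using this.mul_const (‖(evalCLM n).comp R‖ * 1)
    refine squeeze_zero_norm (fun t => ?_) h0
    rw [norm_mul, norm_cexp_I_mul]
    gcongr
    rw [← norm_evolution_delta hH t]
    exact ((evalCLM n).comp R).le_opNorm (ψ t)
  have h := integral_Ioi_of_hasDerivAt_of_tendsto' hd
    ((integrableOn_cexp_mul_evolution hH hz n).const_mul _) hlim
  rw [integral_const_mul] at h
  have h0 : ψ 0 = delta 1 := by simp [hψ, NormedSpace.exp_zero]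
  rw [h0, evalCLM_apply] at h
  simp only [Complex.ofReal_zero, mul_zero, Complex.exp_zero, one_mul, zero_sub] at h
  linear_combination (-Complex.I) * h + (∫ t in Set.Ioi (0 : ℝ),
    Complex.exp (Complex.I * z * t) * ψ t n) * Complex.I_mul_I

/-- The damped evolution at a site, extended by zero to negative times. -/
noncomputable def dampedEvolution (H : ell2Z →L[ℂ] ell2Z) (n : ℤ) (ε : ℝ) : ℝ → ℂ :=
  (Set.Ioi (0 : ℝ)).indicator fun t => Complex.exp (Complex.I * (Complex.I * ε) * t) *
      (NormedSpace.exp ((-(Complex.I * (t : ℂ))) • H) (delta 1) : ell2Z) n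

theorem integrable_dampedEvolution (hH : IsSelfAdjoint H) (n : ℤ) {ε : ℝ} (hε : 0 < ε) :
    Integrable (dampedEvolution H n ε) :=
  (integrableOn_cexp_mul_evolution hH (z := Complex.I * ε) (by simpa using hε) n).integrable_indicator
    measurableSet_Ioi

theorem norm_dampedEvolution_sq (H : ell2Z →L[ℂ] ell2Z) (n : ℤ) (T : ℝ) (t : ℝ) :
    ‖dampedEvolution H n (1 / T) t‖ ^ 2 =
      (Set.Ioi (0 : ℝ)).indicator (fun t => Real.exp (-2 * t / T) * siteProb H n t) t := by
  by_cases ht : t ∈ Set.Ioi (0 : ℝ)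
  · rw [dampedEvolution, Set.indicator_of_mem ht, Set.indicator_of_mem ht, norm_mul, mul_pow,
      siteProb_eq, norm_cexp_I_mul, ← Real.exp_nat_mul]
    congr 2
    simp
    ring
  · rw [dampedEvolution, Set.indicator_of_notMem ht, Set.indicator_of_notMem ht]
    simp

theorem memLp_dampedEvolution (hH : IsSelfAdjoint H) (n : ℤ) {T : ℝ} (hT : 0 < T) :
    MemLp (dampedEvolution H n (1 / T)) 2 := by
  rw [memLp_two_iff_integrable_sq_norm
    (integrable_dampedEvolution hH n (by positivity)).aestronglyMeasurable]
  simp only [norm_dampedEvolution_sq]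
  exact (siteProb_integrableOn hH n hT).integrable_indicator measurableSet_Ioi

/-- The kernel `e^{-2πiξt}` and the damping `e^{-t/T}` combine into `e^{izt}` with `z = -2πξ + i/T`.
-/
theorem norm_fourier_dampedEvolution (hH : IsSelfAdjoint H) (n : ℤ) {T : ℝ} (hT : 0 < T) (ξ : ℝ) :
    ‖𝓕 (dampedEvolution H n (1 / T)) ξ‖ =
      ‖(resolvent H (((-2 * Real.pi * ξ : ℝ) : ℂ) + Complex.I / (T : ℂ)) (delta 1)) n‖ := by
  have hz : 0 < (((-2 * Real.pi * ξ : ℝ) : ℂ) + Complex.I / (T : ℂ)).im := by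
    simp [Complex.div_ofReal_im, hT]
  have h := congrArg norm (integral_cexp_mul_evolution hH hz n)
  rw [norm_mul, Complex.norm_I, one_mul] at h
  rw [← h, Real.fourier_real_eq_integral_exp_smul, ← integral_indicator measurableSet_Ioi]
  congr 1
  refine integral_congr_ae (.of_forall fun t => ?_)
  by_cases ht : t ∈ Set.Ioi (0 : ℝ)
  · simp only [dampedEvolution, Set.indicator_of_mem ht, smul_eq_mul]
    rw [← mul_assoc, ← Complex.exp_add]
    congr 2
    push_cast
    ring
  · simp [dampedEvolution, Set.indicator_of_notMem ht]

theorem integrable_norm_resolvent_sq (hH : IsSelfAdjoint H) (n : ℤ) {T : ℝ} (hT : 0 < T) :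
    Integrable fun E : ℝ =>
      ‖(resolvent H ((E : ℂ) + Complex.I / (T : ℂ)) (delta 1)) n‖ ^ 2 := by
  have h := (memLp_fourier (integrable_dampedEvolution hH n (by positivity))
    (memLp_dampedEvolution hH n hT)).integrable_norm_pow (by norm_num)
  simp only [norm_fourier_dampedEvolution hH n hT] at h
  exact (integrable_comp_mul_left_iff (fun E : ℝ =>
      ‖(resolvent H ((E : ℂ) + Complex.I / (T : ℂ)) (delta 1)) n‖ ^ 2)
    (R := -2 * Real.pi) (by simp [Real.pi_ne_zero])).1 h

/-- Parseval's identity for the time-averaged site probabilities. -/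
theorem avgSiteProb_eq_integral_resolvent (hH : IsSelfAdjoint H) (n : ℤ) {T : ℝ} (hT : 0 < T) :
    avgSiteProb H n T = 1 / (Real.pi * T) *
      ∫ E : ℝ, ‖(resolvent H ((E : ℂ) + Complex.I / (T : ℂ)) (delta 1)) n‖ ^ 2 := by
  have h := integral_norm_sq_fourier (integrable_dampedEvolution hH n (by positivity))
    (memLp_dampedEvolution hH n hT)
  simp only [norm_fourier_dampedEvolution hH n hT, norm_dampedEvolution_sq,
    integral_indicator measurableSet_Ioi] at h
  rw [Measure.integral_comp_mul_left (fun E : ℝ =>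
      ‖(resolvent H ((E : ℂ) + Complex.I / (T : ℂ)) (delta 1)) n‖ ^ 2) (-2 * Real.pi)] at h
  rw [avgSiteProb, ← h, smul_eq_mul, abs_inv, abs_mul, abs_neg, abs_of_pos Real.pi_pos,
    abs_of_pos (by norm_num : (0 : ℝ) < 2)]
  have := Real.pi_pos
  field_simp

/-- For a self-adjoint operator the norm equals the spectral radius. -/
theorem norm_le_of_spectrum_subset (hH : IsSelfAdjoint H) {r : ℝ} (hr : 0 ≤ r)
    (h : spectrum ℂ H ⊆ Complex.ofReal '' Set.Icc (-r) r) : ‖H‖ ≤ r := by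
  have h1 : spectralRadius ℂ H ≤ ENNReal.ofReal r := by
    refine iSup₂_le fun k hk => ?_
    obtain ⟨x, hx, rfl⟩ := h hk
    rw [← enorm_eq_nnnorm, ← ofReal_norm]
    refine ENNReal.ofReal_le_ofReal ?_
    simpa [abs_le] using hx
  rw [hH.spectralRadius_eq_nnnorm, ← enorm_eq_nnnorm, ← ofReal_norm] at h1
  exact (ENNReal.ofReal_le_ofReal_iff hr).1 h1

theorem sum_norm_sq_le (x : ell2Z) (s : Finset ℤ) : ∑ n ∈ s, ‖x n‖ ^ 2 ≤ ‖x‖ ^ 2 := by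
  simpa using lp.sum_rpow_le_norm_rpow (by norm_num : 0 < (2 : ℝ≥0∞).toReal) x s

end Resolvent

/-! ### Exponential decay of the resolvent off the spectrum -/

section Neumann

variable {a b : ℤ → ℝ} (ha : ∃ C, ∀ n, |a n| ≤ C) (hb : ∃ C, ∀ n, |b n| ≤ C)

theorem delta_apply (m n : ℤ) : delta m n = if n = m then 1 else 0 := by
  rw [delta, lp.single_apply]
  simp [Pi.single_apply]

theorem jacobi_pow_delta_apply (m : ℕ) (n : ℤ) (h : (m : ℤ) < |n - 1|) :
    ((jacobi a b ha hb) ^ m) (delta 1) n = 0 := by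
  induction m generalizing n with
  | zero =>
    have : n ≠ 1 := by
      rintro rfl
      simp at h
    simp [delta_apply, this]
  | succ m ih =>
    push_cast at h
    rw [pow_succ', mul_apply_eq_comp, jacobi_apply, ih, ih, ih]
    · simp
    all_goals grind

/-- A finite substitute for the Neumann series: `H u = z u - δ₁`, so `Hᵐ⁺¹ u` and `z Hᵐ u` differ by
`Hᵐ δ₁`, which has not yet reached the site `n`. -/
theorem jacobi_pow_resolvent_apply {z : ℂ} (hz : z.im ≠ 0) (m : ℕ) (n : ℤ)
    (h : (m : ℤ) ≤ |n - 1|) :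
    (z⁻¹ ^ m • ((jacobi a b ha hb) ^ m) (resolvent (jacobi a b ha hb) z (delta 1)) : ell2Z) n =
      resolvent (jacobi a b ha hb) z (delta 1) n := by
  have hz0 : z ≠ 0 := by
    rintro rfl
    simp at hz
  induction m with
  | zero => simp
  | succ m ih =>
    push_cast at h
    rw [← ih (by omega)]
    have h1 := sub_apply_resolvent (jacobi_isSelfAdjoint a b ha hb) hz (delta 1)
    set H := jacobi a b ha hb
    set u := resolvent H z (delta 1)
    have h2 : H u = z • u - delta 1 := by rw [← h1]; abel
    rw [pow_succ H, mul_apply_eq_comp, h2, map_sub, map_smul]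
    have h3 : (H ^ m) (delta 1) n = 0 := jacobi_pow_delta_apply ha hb m n (by omega)
    simp only [lp.coeFn_smul, lp.coeFn_sub, Pi.smul_apply, Pi.sub_apply, smul_eq_mul, h3]
    rw [pow_succ, sub_zero, mul_assoc, inv_mul_cancel_left₀ hz0]

/-- Off the spectrum, the resolvent decays exponentially away from the diagonal. -/
theorem sum_norm_resolvent_sq_le {K : ℝ} (hK : 1 < K) (hnorm : ‖jacobi a b ha hb‖ ≤ K - 1)
    {z : ℂ} (hz : z.im ≠ 0) (hzK : K ≤ ‖z‖) (m : ℕ) (s : Finset ℤ)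
    (hs : ∀ n ∈ s, (m : ℤ) < |n|) :
    ∑ n ∈ s, ‖resolvent (jacobi a b ha hb) z (delta 1) n‖ ^ 2 ≤
      K ^ 2 * ((K - 1) / K) ^ (2 * m) / ‖z‖ ^ 2 := by
  have h1 := sub_apply_resolvent (jacobi_isSelfAdjoint a b ha hb) hz (delta 1)
  have he := fun n (hn : n ∈ s) => jacobi_pow_resolvent_apply ha hb hz m n
    (by have := hs n hn; grind)
  set H := jacobi a b ha hb
  set u := resolvent H z (delta 1)
  have hz0 : 0 < ‖z‖ := by linarith
  have : Nontrivial ell2Z := ⟨delta 1, 0, norm_ne_zero_iff.1 (by simp [norm_delta])⟩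
  have hu : ‖u‖ ≤ K / ‖z‖ := by
    have h2 : ‖z‖ * ‖u‖ ≤ 1 + (K - 1) * ‖u‖ := by
      calc ‖z‖ * ‖u‖ = ‖(z • u - H u) + H u‖ := by simp [norm_smul]
        _ ≤ ‖z • u - H u‖ + ‖H u‖ := norm_add_le _ _
        _ ≤ 1 + (K - 1) * ‖u‖ := by
          rw [h1, norm_delta]
          gcongr
          exact (H.le_opNorm u).trans (by gcongr)
    rw [le_div_iff₀ hz0]
    have h3 : (‖z‖ / K) * ‖u‖ ≤ 1 := by
      -- Equivalent to `K ≤ ‖z‖`. Keeping `1/‖z‖`, rather than a constant, makes the bound square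
      -- integrable in the energy.
      have h4 : ‖z‖ / K ≤ ‖z‖ - (K - 1) := by
        rw [div_le_iff₀ (by linarith)]
        nlinarith
      have := mul_le_mul_of_nonneg_right h4 (norm_nonneg u)
      linarith
    rw [div_mul_eq_mul_div, div_le_one (by linarith)] at h3
    linarith
  calc ∑ n ∈ s, ‖u n‖ ^ 2 = ∑ n ∈ s, ‖(z⁻¹ ^ m • (H ^ m) u : ell2Z) n‖ ^ 2 :=
        Finset.sum_congr rfl fun n hn => by rw [he n hn]
    _ ≤ ‖(z⁻¹ ^ m • (H ^ m) u : ell2Z)‖ ^ 2 := sum_norm_sq_le _ s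
    _ ≤ (((K - 1) / K) ^ m * (K / ‖z‖)) ^ 2 := by
        gcongr
        rw [norm_smul, norm_pow, norm_inv]
        calc ‖z‖⁻¹ ^ m * ‖(H ^ m) u‖ ≤ K⁻¹ ^ m * ((K - 1) ^ m * (K / ‖z‖)) := by
              have : ‖(H ^ m) u‖ ≤ (K - 1) ^ m * (K / ‖z‖) := by
                refine ((H ^ m).le_opNorm u).trans ?_
                have := (norm_pow_le H m).trans (pow_le_pow_left₀ (norm_nonneg _) hnorm m)
                have hK1 : 0 ≤ K - 1 := by linarith
                gcongr
              gcongr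
          _ = _ := by rw [div_pow, inv_pow]; ring
    _ = _ := by rw [mul_comm 2 m, pow_mul]; ring

end Neumann

end OffDiagSturm

/-! ### Sturmian coefficients and properties of the transfer matrices -/

namespace OffDiagSturm

open MeasureTheory

section Hop

variable {l₁ l₂ β : ℝ}

theorem hop_eq_or (l₁ l₂ : ℝ) (hβ : β ∈ Set.Icc (0 : ℝ) 1) (n : ℤ) :
    hop l₁ l₂ β n = l₁ ∨ hop l₁ l₂ β n = l₂ := by
  have h1 : ⌊(n : ℝ) * β⌋ ≤ ⌊((n : ℝ) + 1) * β⌋ := Int.floor_mono (by nlinarith [hβ.1])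
  have h2 : ⌊((n : ℝ) + 1) * β⌋ ≤ ⌊(n : ℝ) * β⌋ + 1 := by
    rw [← Int.floor_add_one]
    exact Int.floor_mono (by nlinarith [hβ.2])
  rcases (by omega : ⌊((n : ℝ) + 1) * β⌋ - ⌊(n : ℝ) * β⌋ = 1 ∨
    ⌊((n : ℝ) + 1) * β⌋ - ⌊(n : ℝ) * β⌋ = 0) with h | h
  · left
    rw [hop, h]
    simp
  · right
    rw [hop, h]
    simp

theorem hop_pos (hl₁ : 0 < l₁) (hl₂ : 0 < l₂) (hβ : β ∈ Set.Icc (0 : ℝ) 1) (n : ℤ) :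
    0 < hop l₁ l₂ β n := by
  rcases hop_eq_or l₁ l₂ hβ n with h | h <;> rw [h] <;> assumption

theorem abs_hop_le (hl₁ : 0 < l₁) (hl₂ : 0 < l₂) (hβ : β ∈ Set.Icc (0 : ℝ) 1) (n : ℤ) :
    |hop l₁ l₂ β n| ≤ l₁ + l₂ := by
  rw [abs_of_pos (hop_pos hl₁ hl₂ hβ n)]
  rcases hop_eq_or l₁ l₂ hβ n with h | h <;> rw [h] <;> linarith

theorem floor_neg_of_irrational {x : ℝ} (hx : Irrational x) : ⌊-x⌋ = -⌊x⌋ - 1 := by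
  rw [Int.floor_eq_iff]
  have h1 := (Int.floor_le x).lt_of_ne (hx.ne_int _).symm
  have h2 := Int.lt_floor_add_one x
  push_cast
  constructor <;> linarith

/-- The hopping sequence is symmetric under reflection away from the origin. -/
theorem hop_reflect (l₁ l₂ : ℝ) (hβ : Irrational β) {n : ℤ} (hn : 1 ≤ n) :
    hop l₁ l₂ β (-n - 1) = hop l₁ l₂ β n := by
  -- Negation turns floors into ceilings, which for irrational arguments only adds `1`; the shifts
  -- cancel in the difference. At `n = 0` the argument `n * β` is an integer, hence `1 ≤ n`.
  have h1 : Irrational ((n : ℝ) * β) := hβ.intCast_mul (by omega)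
  have h2 : Irrational (((n : ℝ) + 1) * β) := by
    exact_mod_cast hβ.intCast_mul (m := n + 1) (by omega)
  rw [hop, hop]
  have e1 : ((-n - 1 : ℤ) : ℝ) * β = -(((n : ℝ) + 1) * β) := by push_cast; ring
  have e2 : (((-n - 1 : ℤ) : ℝ) + 1) * β = -((n : ℝ) * β) := by push_cast; ring
  rw [e1, e2, floor_neg_of_irrational h1, floor_neg_of_irrational h2]
  congr 3
  omega

end Hop

section Transfer

variable {a : ℤ → ℝ}

theorem det_transfer (ha : ∀ n, a n ≠ 0) (n : ℕ) (z : ℂ) : (transfer a n z).det = 1 := by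
  induction n with
  | zero => simp [transfer]
  | succ n ih =>
    have h : (a (n + 1) : ℂ) ≠ 0 := by exact_mod_cast ha _
    rw [transfer, Matrix.det_mul, ih, mul_one, stepMatrix, Matrix.det_smul, Matrix.det_fin_two]
    simp
    field_simp

/-- Determinant one excludes the zero matrix, so the reciprocal of the maximum is a genuine one. -/
theorem transferNorm_pos (ha : ∀ n, a n ≠ 0) (n : ℕ) (z : ℂ) : 0 < transferNorm a n z := by
  refine norm_pos_iff.2 fun h => ?_
  have h0 := (Matrix.toEuclideanCLM (n := Fin 2) (𝕜 := ℂ)).injective (h.trans (map_zero _).symm)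
  have := det_transfer ha n z
  rw [h0] at this
  simp at this

theorem continuous_transfer (a : ℤ → ℝ) (n : ℕ) : Continuous (transfer a n) := by
  induction n with
  | zero => exact continuous_const
  | succ n ih =>
    have h : Continuous (stepMatrix a ((n : ℤ) + 1)) := by
      refine Continuous.const_smul (M := ℂ)
        (g := fun z : ℂ => !![z, -1; (a ((n : ℤ) + 1) : ℂ) ^ 2, 0]) ?_ _
      refine continuous_matrix fun i j => ?_
      fin_cases i <;> fin_cases j <;> simp <;> fun_prop
    exact h.matrix_mul ih

theorem continuous_transferNorm (a : ℤ → ℝ) (n : ℕ) : Continuous (transferNorm a n) := by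
  have h : Continuous (Matrix.toEuclideanCLM (n := Fin 2) (𝕜 := ℂ)) :=
    LinearMap.continuous_of_finiteDimensional
      (Matrix.toEuclideanCLM (n := Fin 2) (𝕜 := ℂ)).toAlgEquiv.toLinearMap
  exact (h.comp (continuous_transfer a n)).norm

theorem continuous_maxTransferSq (a : ℤ → ℝ) (N : ℕ) (hN : 1 ≤ N) :
    Continuous (maxTransferSq a N hN) :=
  Continuous.finset_sup'_apply _ fun n _ => (continuous_transferNorm a n).pow 2

theorem exists_maxTransferSq_eq (a : ℤ → ℝ) (N : ℕ) (hN : 1 ≤ N) (z : ℂ) :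
    ∃ m, 1 ≤ m ∧ m ≤ N ∧ maxTransferSq a N hN z = transferNorm a m z ^ 2 := by
  obtain ⟨m, hm, h⟩ := Finset.exists_mem_eq_sup' (Finset.nonempty_Icc.2 hN)
    fun n => transferNorm a n z ^ 2
  rw [Finset.mem_Icc] at hm
  exact ⟨m, hm.1, hm.2, h⟩

theorem maxTransferSq_pos (ha : ∀ n, a n ≠ 0) (N : ℕ) (hN : 1 ≤ N) (z : ℂ) :
    0 < maxTransferSq a N hN z := by
  obtain ⟨m, -, -, h⟩ := exists_maxTransferSq_eq a N hN z
  rw [h]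
  exact pow_pos (transferNorm_pos ha m z) 2

end Transfer

theorem sum_le_tsum_nat_add {f : ℤ → ℝ} (hf0 : ∀ n, 0 ≤ f n) (hf : Summable f) (m : ℕ)
    (s : Finset ℤ) (hs : ∀ n ∈ s, (m : ℤ) < n) :
    ∑ n ∈ s, f n ≤ ∑' k : ℕ, f ((k + m : ℕ) + 1) := by
  have hinj : Function.Injective fun k : ℕ => (((k + m : ℕ) : ℤ) + 1) := fun i j h => by
    simp only at h
    omega
  have hg := hf.comp_injective hinj
  have e : ∑ n ∈ s, f n = ∑ k ∈ s.preimage (fun k : ℕ => (((k + m : ℕ) : ℤ) + 1)) hinj.injOn,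
      f ((k + m : ℕ) + 1) := by
    rw [Finset.sum_preimage (fun k : ℕ => (((k + m : ℕ) : ℤ) + 1)) s hinj.injOn f]
    intro n hn hn'
    have := hs n hn
    exact absurd ⟨(n - m - 1).toNat, by simp only; omega⟩ hn'
  rw [e]
  exact hg.sum_le_tsum _ fun k _ => hf0 _

theorem summable_norm_sq (x : ell2Z) : Summable fun n => ‖x n‖ ^ 2 :=
  (memℓp_two_iff _).1 (lp.memℓp x)

theorem resolvent_equation (l₁ l₂ β : ℝ) {z : ℂ} (hz : z.im ≠ 0) (n : ℤ) :
    z * resolvent (sturmH l₁ l₂ β) z (delta 1) n -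
      (hop l₁ l₂ β n * resolvent (sturmH l₁ l₂ β) z (delta 1) (n + 1) +
        hop l₁ l₂ β (n - 1) * resolvent (sturmH l₁ l₂ β) z (delta 1) (n - 1)) =
      if n = 1 then 1 else 0 := by
  have h := congrArg (fun x : ell2Z => x n)
    (sub_apply_resolvent (sturmH_isSelfAdjoint l₁ l₂ β) hz (delta 1))
  simp only [lp.coeFn_sub, lp.coeFn_smul, Pi.sub_apply, Pi.smul_apply, smul_eq_mul] at h
  rw [delta_apply] at h
  rw [← h, sturmH, jacobi_apply]
  simp

/-! ### Both tails of the resolvent against the transfer matrices -/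

section Tails

variable {l₁ l₂ β : ℝ}

theorem right_tail_le (hl₁ : 0 < l₁) (hl₂ : 0 < l₂) (hβ : β ∈ Set.Icc (0 : ℝ) 1)
    {z : ℂ} {K : ℝ} (hz : 0 < z.im) (hzK : z.im ≤ K) {m : ℕ} (hm : 1 ≤ m)
    (s : Finset ℤ) (hs : ∀ n ∈ s, (m : ℤ) < n) :
    (∑ n ∈ s, ‖resolvent (sturmH l₁ l₂ β) z (delta 1) n‖ ^ 2) *
      transferNorm (hop l₁ l₂ β) m z ^ 2 ≤
        (1 + (l₁ + l₂ + K) ^ 2) * (1 + (l₁ + l₂) ^ 2) / z.im ^ 4 := by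
  have heq := resolvent_equation l₁ l₂ β hz.ne'
  have hu := norm_resolvent_delta_le (sturmH_isSelfAdjoint l₁ l₂ β) hz 1
  set u := resolvent (sturmH l₁ l₂ β) z (delta 1)
  have hu' : ∀ n, ‖u n‖ ≤ 1 / z.im := fun n => (lp.norm_apply_le_norm (by norm_num) u n).trans hu
  have ha := fun n => (hop_pos hl₁ hl₂ hβ n).ne'
  have hL := abs_hop_le hl₁ hl₂ hβ
  -- The source at site `1` is absorbed into `q 0` as the extra `1`, so the homogeneous equation
  -- holds from the origin on.
  have hsol : IsSolution (fun n => hop l₁ l₂ β (n + 1)) z (fun n => u (n + 1))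
      (fun n => if n = 0 then hop l₁ l₂ β 0 * u 0 + 1 else hop l₁ l₂ β n * u n) := fun n => by
    refine ⟨by simp, ?_⟩
    have h := heq (n + 1)
    rcases Nat.eq_zero_or_pos n with rfl | hn
    · simp at h ⊢
      linear_combination -h
    · rw [if_neg (by omega), add_sub_cancel_right] at h
      dsimp only
      rw [if_neg (by omega)]
      push_cast
      linear_combination -h
  have hsum : Summable fun k : ℕ => ‖u (k + 1)‖ ^ 2 :=
    (summable_norm_sq u).comp_injective (i := fun k : ℕ => (k : ℤ) + 1) fun i j h => by
      simpa using h
  have key := hsol.tail_mul_transferNorm_le ha hL hsum hz hm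
  have hp : ‖u 1‖ ^ 2 ≤ 1 / z.im ^ 2 := by
    rw [← one_div_pow]
    exact pow_le_pow_left₀ (norm_nonneg _) (hu' 1) 2
  have hq : ‖hop l₁ l₂ β 0 * u 0 + 1‖ ^ 2 ≤ (l₁ + l₂ + K) ^ 2 / z.im ^ 2 := by
    rw [← div_pow]
    refine pow_le_pow_left₀ (norm_nonneg _) ((norm_add_le _ _).trans ?_) 2
    rw [norm_mul, Complex.norm_real, Real.norm_eq_abs, norm_one, add_div]
    refine add_le_add ?_ ((one_le_div hz).2 hzK)
    rw [← mul_one_div]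
    exact mul_le_mul (hL 0) (hu' 0) (norm_nonneg _) (by positivity)
  calc _ ≤ (∑' k : ℕ, ‖u ((k + m : ℕ) + 1)‖ ^ 2) * transferNorm (hop l₁ l₂ β) m z ^ 2 := by
        gcongr
        exact sum_le_tsum_nat_add (fun n => sq_nonneg ‖u n‖) (summable_norm_sq u) m s hs
    _ ≤ _ := key
    _ ≤ (1 / z.im ^ 2 + (l₁ + l₂ + K) ^ 2 / z.im ^ 2) / z.im ^ 2 * (1 + (l₁ + l₂) ^ 2) := by
        simp only [CharP.cast_eq_zero, zero_add, if_true]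
        gcongr
    _ = _ := by
        field_simp

theorem left_tail_le (hl₁ : 0 < l₁) (hl₂ : 0 < l₂) (hβ : β ∈ Set.Icc (0 : ℝ) 1)
    (hirr : Irrational β) {z : ℂ} {K : ℝ} (hz : 0 < z.im) (hK : 0 ≤ K) {m : ℕ}
    (hm : 1 ≤ m) (s : Finset ℤ) (hs : ∀ n ∈ s, (m : ℤ) < -n) :
    (∑ n ∈ s, ‖resolvent (sturmH l₁ l₂ β) z (delta 1) n‖ ^ 2) *
      transferNorm (hop l₁ l₂ β) m z ^ 2 ≤
        (1 + (l₁ + l₂ + K) ^ 2) * (1 + (l₁ + l₂) ^ 2) / z.im ^ 4 := by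
  have heq := resolvent_equation l₁ l₂ β hz.ne'
  have hu := norm_resolvent_delta_le (sturmH_isSelfAdjoint l₁ l₂ β) hz 1
  set u := resolvent (sturmH l₁ l₂ β) z (delta 1)
  have hu' : ∀ n, ‖u n‖ ≤ 1 / z.im := fun n => (lp.norm_apply_le_norm (by norm_num) u n).trans hu
  have ha := fun n => (hop_pos hl₁ hl₂ hβ n).ne'
  have hL := abs_hop_le hl₁ hl₂ hβ
  -- Site `-(n + 1)` plays the role of `n + 1`, and reflection restores the same coefficients. It
  -- does not cover the bond from `-1` to `0`, so `q 0` keeps `hop l₁ l₂ β (-1)`.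
  have hsol : IsSolution (fun n => hop l₁ l₂ β (n + 1)) z (fun n => u (-((n : ℤ) + 1)))
      (fun n => if n = 0 then hop l₁ l₂ β (-1) * u 0 else hop l₁ l₂ β n * u (-n)) := fun n => by
    refine ⟨by simp, ?_⟩
    have h := heq (-((n : ℤ) + 1))
    rw [if_neg (by omega), hop_reflect l₁ l₂ hirr (by omega)] at h
    have e1 : -((n : ℤ) + 1) - 1 = -(((n + 1 : ℕ) : ℤ) + 1) := by push_cast; ring
    have e2 : -((n : ℤ) + 1) + 1 = -n := by ring
    rw [e1, e2] at h
    rcases Nat.eq_zero_or_pos n with rfl | hn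
    · simp at h ⊢
      linear_combination -h
    · rw [show -((n : ℤ) + 1) = -n - 1 by ring, hop_reflect l₁ l₂ hirr (by omega)] at h
      dsimp only
      rw [if_neg (by omega), show -((n : ℤ) + 1) = -n - 1 by ring]
      linear_combination -h
  have hsumm : Summable fun n : ℤ => ‖u (-n)‖ ^ 2 :=
    (summable_norm_sq u).comp_injective neg_injective
  have hsum : Summable fun k : ℕ => ‖u (-((k : ℤ) + 1))‖ ^ 2 :=
    hsumm.comp_injective (i := fun k : ℕ => (k : ℤ) + 1) fun i j h => by simpa using h
  have key := hsol.tail_mul_transferNorm_le ha hL hsum hz hm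
  have hp : ‖u (-1)‖ ^ 2 ≤ 1 / z.im ^ 2 := by
    rw [← one_div_pow]
    exact pow_le_pow_left₀ (norm_nonneg _) (hu' _) 2
  have hq : ‖hop l₁ l₂ β (-1) * u 0‖ ^ 2 ≤ (l₁ + l₂ + K) ^ 2 / z.im ^ 2 := by
    rw [← div_pow]
    refine pow_le_pow_left₀ (norm_nonneg _) ?_ 2
    rw [norm_mul, Complex.norm_real, Real.norm_eq_abs, ← mul_one_div]
    exact mul_le_mul ((hL _).trans (by linarith)) (hu' 0) (norm_nonneg _) (by positivity)
  have e : ∑ n ∈ s, ‖u n‖ ^ 2 = ∑ n ∈ s.map (Equiv.neg ℤ).toEmbedding, ‖u (-n)‖ ^ 2 := by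
    simp
  calc _ ≤ (∑' k : ℕ, ‖u (-(((k + m : ℕ) : ℤ) + 1))‖ ^ 2) *
          transferNorm (hop l₁ l₂ β) m z ^ 2 := by
        gcongr
        rw [e]
        refine sum_le_tsum_nat_add (fun n => sq_nonneg ‖u (-n)‖) hsumm m _ fun n hn => ?_
        obtain ⟨k, hk, rfl⟩ := Finset.mem_map.1 hn
        exact hs k hk
    _ ≤ _ := key
    _ ≤ (1 / z.im ^ 2 + (l₁ + l₂ + K) ^ 2 / z.im ^ 2) / z.im ^ 2 * (1 + (l₁ + l₂) ^ 2) := by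
        simp only [CharP.cast_eq_zero, zero_add, if_true]
        gcongr
    _ = _ := by
        field_simp

/-- The resolvent outside `[-N, N]` is bounded by the inverse of the transfer matrices. -/
theorem sum_norm_resolvent_sq_le_inv_maxTransferSq (hl₁ : 0 < l₁) (hl₂ : 0 < l₂) (hβ : β ∈ Set.Icc (0 : ℝ) 1)
    (hirr : Irrational β) {z : ℂ} {K : ℝ}
    (hz : 0 < z.im) (hzK : z.im ≤ K) (N : ℕ) (hN : 1 ≤ N) (s : Finset ℤ)
    (hs : ∀ n ∈ s, (N : ℤ) < |n|) :
    ∑ n ∈ s, ‖resolvent (sturmH l₁ l₂ β) z (delta 1) n‖ ^ 2 ≤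
      2 * ((1 + (l₁ + l₂ + K) ^ 2) * (1 + (l₁ + l₂) ^ 2)) / z.im ^ 4 *
        (maxTransferSq (hop l₁ l₂ β) N hN z)⁻¹ := by
  have hpos := maxTransferSq_pos (fun n => (hop_pos hl₁ hl₂ hβ n).ne') N hN z
  -- The tail beyond `N` lies in the tail beyond the maximizing `m ≤ N`, so one index serves both
  -- half-lines.
  obtain ⟨m, hm1, hmN, hm⟩ := exists_maxTransferSq_eq (hop l₁ l₂ β) N hN z
  rw [← div_eq_mul_inv, le_div_iff₀ hpos, hm,
    ← Finset.sum_filter_add_sum_filter_not s fun n => 0 < n, add_mul]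
  have h1 := right_tail_le hl₁ hl₂ hβ hz hzK hm1 (s.filter fun n => 0 < n) fun n hn => by
    rw [Finset.mem_filter] at hn
    have := hs n hn.1
    rw [abs_of_pos hn.2] at this
    omega
  have h2 := left_tail_le hl₁ hl₂ hβ hirr hz (hz.le.trans hzK) hm1
    (s.filter fun n => ¬ 0 < n) fun n hn => by
      rw [Finset.mem_filter] at hn
      have := hs n hn.1
      rw [abs_of_nonpos (not_lt.1 hn.2)] at this
      omega
  refine (add_le_add h1 h2).trans_eq ?_
  ring

end Tails

end OffDiagSturm

/-! ### Integration over the energy and conclusion -/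

namespace OffDiagSturm

open MeasureTheory

theorem integrable_inv_one_add_mul_sq {T : ℝ} (hT : 0 < T) :
    Integrable fun E : ℝ => (1 + (T * E) ^ 2)⁻¹ :=
  (integrable_comp_mul_left_iff (fun x : ℝ => (1 + x ^ 2)⁻¹) hT.ne').2 integrable_inv_one_add_sq

theorem integral_inv_one_add_mul_sq {T : ℝ} (hT : 0 < T) :
    ∫ E : ℝ, (1 + (T * E) ^ 2)⁻¹ = Real.pi / T := by
  rw [Measure.integral_comp_mul_left (fun x : ℝ => (1 + x ^ 2)⁻¹), integral_univ_inv_one_add_sq,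
    abs_of_pos (by positivity), smul_eq_mul]
  ring

theorem norm_add_I_div_sq (E T : ℝ) :
    ‖(E : ℂ) + Complex.I / (T : ℂ)‖ ^ 2 = E ^ 2 + (1 / T) ^ 2 := by
  rw [← Complex.normSq_eq_norm_sq, Complex.normSq_apply]
  simp [Complex.div_ofReal_im, Complex.div_ofReal_re]
  ring

/-- The bound on the resolvent outside `[-N, N]` at a given energy. -/
theorem sum_norm_resolvent_sq_le_add {l₁ l₂ β K : ℝ} (hl₁ : 0 < l₁) (hl₂ : 0 < l₂) (hK : 1 < K)
    (hβ : β ∈ Set.Icc (0 : ℝ) 1) (hirr : Irrational β) (hnorm : ‖sturmH l₁ l₂ β‖ ≤ K - 1)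
    {N : ℕ} (hN : 1 ≤ N) {T : ℝ} (hT : 0 < T) (E : ℝ) (s : Finset ℤ)
    (hs : ∀ n ∈ s, (N : ℤ) < |n|) :
    ∑ n ∈ s, ‖resolvent (sturmH l₁ l₂ β) ((E : ℂ) + Complex.I / (T : ℂ)) (delta 1) n‖ ^ 2 ≤
      K ^ 2 * ((K - 1) / K) ^ (2 * N) * T ^ 2 * (1 + (T * E) ^ 2)⁻¹ +
        (Set.Ioc (-K) K).indicator (fun E : ℝ =>
          2 * ((1 + (l₁ + l₂ + K) ^ 2) * (1 + (l₁ + l₂) ^ 2)) * T ^ 4 *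
            (maxTransferSq (hop l₁ l₂ β) N hN ((E : ℂ) + Complex.I / (T : ℂ)))⁻¹) E := by
  have him : ((E : ℂ) + Complex.I / (T : ℂ)).im = 1 / T := by simp [Complex.div_ofReal_im]
  have hz : 0 < ((E : ℂ) + Complex.I / (T : ℂ)).im := by rw [him]; positivity
  have hpos := fun z => maxTransferSq_pos (fun n => (hop_pos hl₁ hl₂ hβ n).ne') N hN z
  have h1 : 0 ≤ K ^ 2 * ((K - 1) / K) ^ (2 * N) * T ^ 2 * (1 + (T * E) ^ 2)⁻¹ := by
    have := (even_two_mul N).pow_nonneg ((K - 1) / K)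
    positivity
  have h2 : 0 ≤ (Set.Ioc (-K) K).indicator (fun E : ℝ =>
          2 * ((1 + (l₁ + l₂ + K) ^ 2) * (1 + (l₁ + l₂) ^ 2)) * T ^ 4 *
            (maxTransferSq (hop l₁ l₂ β) N hN ((E : ℂ) + Complex.I / (T : ℂ)))⁻¹) E :=
    Set.indicator_nonneg (fun E _ => by have := hpos ((E : ℂ) + Complex.I / (T : ℂ)); positivity) E
  -- Each case needs only one of the two nonnegative terms. Small `T` belongs to the second case: `1
  -- / T > K` already gives `‖z‖ ≥ K`.
  by_cases hE : E ∈ Set.Ioc (-K) K ∧ 1 / T ≤ K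
  · have h := sum_norm_resolvent_sq_le_inv_maxTransferSq hl₁ hl₂ hβ hirr hz
      (him.trans_le hE.2) N hN s hs
    rw [Set.indicator_of_mem hE.1] at h2 ⊢
    rw [him, one_div_pow, div_div_eq_mul_div, div_one] at h
    linarith
  · have hzK : K ≤ ‖(E : ℂ) + Complex.I / (T : ℂ)‖ := by
      rw [not_and_or, Set.mem_Ioc, not_and_or] at hE
      have : 0 < 1 / T := by positivity
      refine le_of_sq_le_sq ?_ (norm_nonneg _)
      rw [norm_add_I_div_sq E T]
      rcases hE with (h | h) | h <;> nlinarith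
    have h := sum_norm_resolvent_sq_le (hop_bounded l₁ l₂ β) ⟨0, fun _ => by simp⟩ hK hnorm hz.ne'
      hzK N s hs
    have e : T ^ 2 * (1 + (T * E) ^ 2)⁻¹ = (E ^ 2 + (1 / T) ^ 2)⁻¹ := by
      field_simp
      ring
    rw [norm_add_I_div_sq E T, div_eq_mul_inv (K ^ 2 * _), ← e] at h
    have h' : ∑ n ∈ s, ‖resolvent (sturmH l₁ l₂ β) ((E : ℂ) + Complex.I / (T : ℂ))
      (delta 1) n‖ ^ 2 ≤ _ := h
    linarith

end OffDiagSturm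

open MeasureTheory OffDiagSturm in
theorem theorem2 (l₁ l₂ K : ℝ) (hl₁ : 0 < l₁) (hl₂ : 0 < l₂) (hK : 4 ≤ K) :
    ∃ c : ℝ, 0 < c ∧ ∃ C : ℝ, 0 < C ∧
      ∀ β ∈ Set.Icc (0 : ℝ) 1, Irrational β →
        spectrum ℂ (OffDiagSturm.sturmH l₁ l₂ β) ⊆
          Complex.ofReal '' Set.Icc (-K + 1) (K - 1) →
        ∀ (N : ℕ) (hN : 1 ≤ N) (T : ℝ), 0 < T →
          OffDiagSturm.avgOutsideProb (OffDiagSturm.sturmH l₁ l₂ β) N T ≤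
            C * (Real.exp (-c * N) +
              T ^ 3 * ∫ E in (-K)..K,
                (OffDiagSturm.maxTransferSq (OffDiagSturm.hop l₁ l₂ β) N hN
                  ((E : ℂ) + Complex.I / (T : ℂ)))⁻¹) := by
  have hK0 : 0 < K := by linarith
  have hK1 : 0 < K - 1 := by linarith
  set D := 2 * ((1 + (l₁ + l₂ + K) ^ 2) * (1 + (l₁ + l₂) ^ 2)) with hD
  have hD0 : 0 < D := by positivity
  -- With this `c`, `e^{-cN}` is exactly the decay factor `((K - 1) / K) ^ (2 * N)`.
  refine ⟨2 * Real.log (K / (K - 1)), ?_, K ^ 2 + D, by positivity, ?_⟩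
  · have : 0 < Real.log (K / (K - 1)) := Real.log_pos ((one_lt_div hK1).2 (by linarith))
    positivity
  intro β hβ hirr hspec N hN T hT
  have hH := sturmH_isSelfAdjoint l₁ l₂ β
  have hnorm : ‖sturmH l₁ l₂ β‖ ≤ K - 1 := by
    refine norm_le_of_spectrum_subset hH hK1.le ?_
    rwa [neg_sub, ← neg_add_eq_sub]
  have hexp : Real.exp (-(2 * Real.log (K / (K - 1))) * N) = ((K - 1) / K) ^ (2 * N) := by
    rw [show -(2 * Real.log (K / (K - 1))) * N =
      ((2 * N : ℕ) : ℝ) * -Real.log (K / (K - 1)) by push_cast; ring, Real.exp_nat_mul,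
      Real.exp_neg, Real.exp_log (by positivity), inv_div]
  rw [hexp]
  set ρ := ((K - 1) / K) ^ (2 * N)
  have hρ : 0 ≤ ρ := by positivity
  have hapos := fun z =>
    maxTransferSq_pos (fun n => (hop_pos hl₁ hl₂ hβ n).ne') N hN z
  set G : ℝ → ℝ := fun E =>
    (maxTransferSq (hop l₁ l₂ β) N hN ((E : ℂ) + Complex.I / (T : ℂ)))⁻¹ with hG
  have hGc : Continuous G :=
    ((continuous_maxTransferSq (hop l₁ l₂ β) N hN).comp (by fun_prop)).inv₀
      fun E => (hapos _).ne'
  have hGint : IntegrableOn G (Set.Ioc (-K) K) :=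
    (hGc.integrableOn_Icc (a := -K) (b := K)).mono_set Set.Ioc_subset_Icc_self
  have hI0 : 0 ≤ ∫ E in Set.Ioc (-K) K, G E :=
    integral_nonneg fun E => inv_nonneg.2 (hapos _).le
  rw [intervalIntegral.integral_of_le (by linarith)]
  -- Finite partial sums suffice, so only a finite sum is exchanged with the energy integral.
  refine ((avgSiteProb_summable hH hT).subtype _).tsum_le_of_sum_le fun s => ?_
  have hs : ∀ n ∈ s.map (Function.Embedding.subtype _), (N : ℤ) < |n| := fun n hn => by
    obtain ⟨k, -, rfl⟩ := Finset.mem_map.1 hn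
    exact k.2
  have e : ∑ n ∈ s, avgSiteProb (sturmH l₁ l₂ β) n T =
      ∑ n ∈ s.map (Function.Embedding.subtype _), avgSiteProb (sturmH l₁ l₂ β) n T := by
    simp
  refine e.trans_le ?_
  simp only [avgSiteProb_eq_integral_resolvent hH _ hT]
  rw [← Finset.mul_sum, ← integral_finsetSum _ fun n _ => integrable_norm_resolvent_sq hH n hT]
  have hB1 : Integrable fun E : ℝ => K ^ 2 * ρ * T ^ 2 * (1 + (T * E) ^ 2)⁻¹ :=
    (integrable_inv_one_add_mul_sq hT).const_mul _
  have hGD : IntegrableOn (fun E => D * T ^ 4 * G E) (Set.Ioc (-K) K) := hGint.const_mul _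
  have hB2 : Integrable ((Set.Ioc (-K) K).indicator fun E => D * T ^ 4 * G E) :=
    hGD.integrable_indicator measurableSet_Ioc
  have hle := integral_mono
    (integrable_finsetSum _ fun n _ => integrable_norm_resolvent_sq hH n hT) (hB1.add hB2)
    fun E => sum_norm_resolvent_sq_le_add hl₁ hl₂ (by linarith) hβ hirr hnorm hN hT E _ hs
  have hval : ∫ E : ℝ, (K ^ 2 * ρ * T ^ 2 * (1 + (T * E) ^ 2)⁻¹ +
      (Set.Ioc (-K) K).indicator (fun E => D * T ^ 4 * G E) E) =
      K ^ 2 * ρ * T ^ 2 * (Real.pi / T) + D * T ^ 4 * ∫ E in Set.Ioc (-K) K, G E := by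
    rw [integral_add hB1 hB2, integral_const_mul, integral_inv_one_add_mul_sq hT,
      integral_indicator measurableSet_Ioc, integral_const_mul]
  have hpi := Real.pi_pos
  -- The prefactor cancels `∫ dE / (E² + T⁻²) = πT`, so the first term is free of `T`.
  calc _ ≤ 1 / (Real.pi * T) *
        (K ^ 2 * ρ * T ^ 2 * (Real.pi / T) + D * T ^ 4 * ∫ E in Set.Ioc (-K) K, G E) :=
        mul_le_mul_of_nonneg_left (hle.trans_eq hval) (by positivity)
    _ = K ^ 2 * ρ + D / Real.pi * (T ^ 3 * ∫ E in Set.Ioc (-K) K, G E) := by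
        field_simp
    _ ≤ K ^ 2 * ρ + D * (T ^ 3 * ∫ E in Set.Ioc (-K) K, G E) := by
        gcongr
        exact div_le_self hD0.le (by linarith [Real.pi_gt_three])
    _ ≤ (K ^ 2 + D) * (ρ + T ^ 3 * ∫ E in Set.Ioc (-K) K, G E) := by
        have h3 : 0 ≤ T ^ 3 * ∫ E in Set.Ioc (-K) K, G E := by positivity
        nlinarith [mul_nonneg hD0.le hρ, mul_nonneg (sq_nonneg K) h3]
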